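/- Let $K$ be a field, $S=K[x_1,\ldots,x_n]$, and let $I\subsetneq S$ be a monomial ideal that is an almost complete intersection, i.e. its minimal number of generators equals $\operatorname{ht}(I)+1$. Then Stanley's conjecture holds for $S/I$ and for $I$: $$\operatorname{depth}_S(S/I)\le \operatorname{sdepth}_S(S/I)\quad\text{and}\quad \operatorname{depth}_S(I)\le \operatorname{sdepth}_S(I).$$ Here $\operatorname{depth}_S(M)$ is the maximal length of an $M$-regular sequence in $(x_1,\ldots,x_n)$. For a nonzero finitely generated $\mathbb Z^n$-graded $S$-module $M$, $\operatorname{sdepth}_S(M)$ is the maximum of $\min_{1\le i\le r}|Z_i|$ over all Stanley decompositions of $M$, that is, all finite direct sum decompositions $M=\bigoplus_{i=1}^r m_iK[Z_i]$ of $K$-vector spaces, where each $m_i\in M$ is homogeneous, $Z_i\subseteq\{x_1,\ldots,x_n\}$, and $m_iK[Z_i]$ is a free $K[Z_i]$-module with basis $m_i$. -/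

import Mathlib

noncomputable section

namespace StanleyDepth

open MvPolynomial

/-- The polynomial ring `S = K[x_1, …, x_n]`. -/
abbrev PolyRing (K : Type*) [Field K] (n : ℕ) : Type _ := MvPolynomial (Fin n) K

/-- The graded maximal ideal `(x_1, …, x_n)` of `S`. -/
def gradedMaximalIdeal (K : Type*) [Field K] (n : ℕ) : Ideal (PolyRing K n) :=
  Ideal.span (Set.range (X : Fin n → PolyRing K n))

/-- The depth of an `S`-module `M`: the supremum of the lengths of the `M`-regular sequences with
entries in the graded maximal ideal. -/
def depth (K : Type*) [Field K] (n : ℕ) (M : Type*) [AddCommGroup M] [Module (PolyRing K n) M] :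
    ℕ∞ :=
  ⨆ (rs : List (PolyRing K n)) (_ : ∀ r ∈ rs, r ∈ gradedMaximalIdeal K n)
    (_ : RingTheory.Sequence.IsRegular M rs), (rs.length : ℕ∞)

/-- A monomial ideal: an ideal generated by a set of monomials. -/
def IsMonomialIdeal {K : Type*} [Field K] {n : ℕ} (I : Ideal (PolyRing K n)) : Prop :=
  ∃ A : Set (Fin n →₀ ℕ), I = Ideal.span ((fun a => monomial a (1 : K)) '' A)

/-- An almost complete intersection ideal: a proper ideal whose minimal number of generators is
its height plus one. -/
def IsAlmostCompleteIntersection {R : Type*} [CommRing R] (I : Ideal R) : Prop :=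
  I ≠ ⊤ ∧ I.FG ∧ (Submodule.spanFinrank I : ℕ∞) = I.height + 1

/-- The `ℤ^n`-grading of `S`: the component of degree `a` consists of the polynomials all of whose
monomials have exponent vector `a` (so it is spanned by `x^a` if `a ≥ 0`, and zero otherwise). -/
def multigrading (K : Type*) [Field K] (n : ℕ) (a : Fin n → ℤ) : Submodule K (PolyRing K n) :=
  weightedHomogeneousSubmodule K (fun i : Fin n => (Pi.single i 1 : Fin n → ℤ)) a

/-- The `ℤ^n`-grading of a monomial ideal `I`, induced from `S`. -/
def idealGrading {K : Type*} [Field K] {n : ℕ} (I : Ideal (PolyRing K n)) (a : Fin n → ℤ) :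
    Submodule K I :=
  (multigrading K n a).comap (I.subtype.restrictScalars K)

/-- The `ℤ^n`-grading of `S/I` for a monomial ideal `I`, induced from `S`. -/
def quotientGrading {K : Type*} [Field K] {n : ℕ} (I : Ideal (PolyRing K n)) (a : Fin n → ℤ) :
    Submodule K (PolyRing K n ⧸ I) :=
  (multigrading K n a).map (I.mkQ.restrictScalars K)

section Stanley

variable {K : Type*} [Field K] {n : ℕ} {M : Type*} [AddCommGroup M] [Module (PolyRing K n) M]
  [Module K M] [IsScalarTower K (PolyRing K n) M]

/-- The `K`-subspace `m K[Z] = {f m : f ∈ K[Z]}` of `M`. -/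
def stanleySpace (K : Type*) [Field K] {n : ℕ} {M : Type*} [AddCommGroup M]
    [Module (PolyRing K n) M] [Module K M] [IsScalarTower K (PolyRing K n) M] (m : M) (Z : Finset (Fin n)) : Submodule K M :=
  (Subalgebra.toSubmodule (supported K (Z : Set (Fin n)))).map
    ((LinearMap.toSpanSingleton (PolyRing K n) M m).restrictScalars K)

/-- A Stanley decomposition of a `ℤ^n`-graded `S`-module `M` with homogeneous components `𝒜 a`:
a finite decomposition `M = ⨁ i, m_i K[Z_i]` as a `K`-vector space, with `m_i` homogeneous and
`m_i K[Z_i]` free over `K[Z_i]` on `m_i`. -/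
structure StanleyDecomposition (𝒜 : (Fin n → ℤ) → Submodule K M) where
  r : ℕ
  m : Fin r → M
  Z : Fin r → Finset (Fin n)
  homogeneous : ∀ i, ∃ a, m i ∈ 𝒜 a
  free : ∀ i, ∀ f : PolyRing K n, f ∈ supported K (Z i : Set (Fin n)) → f • m i = 0 → f = 0
  isInternal : DirectSum.IsInternal fun i => stanleySpace K (m i) (Z i)

/-- The Stanley depth of a Stanley decomposition: the minimum of the `|Z_i|`. -/
def StanleyDecomposition.sdepth {𝒜 : (Fin n → ℤ) → Submodule K M}
    (D : StanleyDecomposition 𝒜) : ℕ∞ :=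
  ⨅ i, ((D.Z i).card : ℕ∞)

/-- The Stanley depth of a `ℤ^n`-graded module: the maximum of the Stanley depths of its Stanley
decompositions. -/
def sdepth (𝒜 : (Fin n → ℤ) → Submodule K M) : ℕ∞ :=
  ⨆ D : StanleyDecomposition 𝒜, D.sdepth

end Stanley

end StanleyDepth

end

/-! Let G be the set of minimal monomial generators of I, so |G| ≤ ht I + 1. Partitioning the
exponents outside or inside I into boxes gives Stanley decompositions of S/I and of I. Cutting into
slices costs at most one free direction per generator, whence sdepth S/I ≥ n - |G| and sdepth I ≥ n
+ 1 - |G| (`boxPartition_avoiding`, `boxPartition_upperClosure`). In the other direction, an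
associated prime P of S/I inside the graded maximal ideal forces depth S/I ≤ n - ht P and depth I ≤
n + 1 - ht P.

A dichotomy makes the two bounds meet. If every generator has a variable in which its exponent
strictly exceeds that of all the others, these |G| variables generate an associated prime of height
|G| (`span_X_image_mem_associatedPrimes`). Otherwise some generator u is dominated, variable by
variable, by other generators. Then a slice that rules out u rules out a second generator as well,
one free direction is saved (`boxPartition_avoiding_insert`, `boxPartition_upperClosure_insert`),
and a minimal prime of I, of height at least |G| - 1, suffices. -/

noncomputable section

namespace StanleyDepth

/-! ### Combinatorics: partitions of exponent sets into boxes -/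

section Boxes

variable {σ : Type*}

/-- The exponent vectors of the monomials in `x^a K[Z]`. -/
def box (a : σ →₀ ℕ) (Z : Finset σ) : Set (σ →₀ ℕ) :=
  {b | a ≤ b ∧ ∀ x ∉ Z, b x = a x}

/-- `A` is a finite disjoint union of boxes with at least `k` free directions each. -/
inductive BoxPartition (k : ℕ) : Set (σ →₀ ℕ) → Prop
  | empty : BoxPartition k ∅
  | of_box (a : σ →₀ ℕ) (Z : Finset σ) (h : k ≤ Z.card) : BoxPartition k (box a Z)
  | union (A B : Set (σ →₀ ℕ)) (hd : Disjoint A B) (hA : BoxPartition k A)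
      (hB : BoxPartition k B) : BoxPartition k (A ∪ B)

theorem BoxPartition.exists_family {k : ℕ} {A : Set (σ →₀ ℕ)} (h : BoxPartition k A) :
    ∃ (r : ℕ) (a : Fin r → σ →₀ ℕ) (Z : Fin r → Finset σ), (∀ i, k ≤ (Z i).card) ∧
      (⋃ i, box (a i) (Z i)) = A ∧
      Pairwise fun i j => Disjoint (box (a i) (Z i)) (box (a j) (Z j)) := by
  induction h with
  | empty => exact ⟨0, Fin.elim0, Fin.elim0, fun i => i.elim0, by simp, fun i => i.elim0⟩
  | of_box a Z h =>
    refine ⟨1, fun _ => a, fun _ => Z, fun _ => h, Set.iUnion_const _, fun i j hij => ?_⟩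
    exact (hij (Subsingleton.elim _ _)).elim
  | union A B hd hA hB ihA ihB =>
    obtain ⟨r, a, Z, hk, hU, hP⟩ := ihA
    obtain ⟨s, a', Z', hk', hU', hP'⟩ := ihB
    have key (i : Fin r) (j : Fin s) :
        Disjoint (box (a i) (Z i)) (box (a' j) (Z' j)) :=
      hd.mono (hU ▸ Set.subset_iUnion (fun i => box (a i) (Z i)) i)
        (hU' ▸ Set.subset_iUnion (fun i => box (a' i) (Z' i)) j)
    refine ⟨r + s, Fin.append a a', Fin.append Z Z', ?_, ?_, ?_⟩
    · exact fun i => Fin.addCases (by simpa using hk) (by simpa using hk') i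
    · rw [← hU, ← hU']
      ext b
      simp only [Set.mem_iUnion, Set.mem_union]
      constructor
      · rintro ⟨i, hi⟩
        revert hi
        refine Fin.addCases (fun i hi => ?_) (fun i hi => ?_) i
        · exact Or.inl ⟨i, by simpa using hi⟩
        · exact Or.inr ⟨i, by simpa using hi⟩
      · rintro (⟨i, hi⟩ | ⟨i, hi⟩)
        · exact ⟨Fin.castAdd s i, by simpa using hi⟩
        · exact ⟨Fin.natAdd r i, by simpa using hi⟩
    · intro i j
      refine Fin.addCases (fun i => ?_) (fun i => ?_) i <;>
        refine Fin.addCases (fun j => ?_) (fun j => ?_) j <;> intro hij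
      · simpa using hP fun h => hij (by rw [h])
      · simpa using key i j
      · simpa using (key j i).symm
      · simpa using hP' fun h => hij (by rw [h])

/-- The exponent vectors in the box at `c` with free directions `V` that do not lie above any
element of `U`. -/
def avoiding (V : Finset σ) (c : σ →₀ ℕ) (U : Finset (σ →₀ ℕ)) : Set (σ →₀ ℕ) :=
  {b | b ∈ box c V ∧ ∀ u ∈ U, ¬ u ≤ b}

theorem avoiding_eq_empty {V : Finset σ} {c : σ →₀ ℕ} {U : Finset (σ →₀ ℕ)} {u : σ →₀ ℕ}
    (hu : u ∈ U) (huc : u ≤ c) : avoiding V c U = ∅ :=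
  Set.eq_empty_of_forall_notMem fun _ hb => hb.2 u hu (huc.trans hb.1.1)

theorem disjoint_avoiding (u : σ →₀ ℕ) (V : Finset σ) (U : Finset (σ →₀ ℕ)) :
    Disjoint {b | ∃ v ∈ U, v ≤ b} (avoiding V u U) :=
  Set.disjoint_left.2 fun _ ⟨v, hv, hvb⟩ hb => hb.2 v hv hvb

variable [DecidableEq σ]

/-- The coordinate `x` is frozen at a value below `u x`, so no point of the box lies above `u`. -/
theorem avoiding_erase {V : Finset σ} {c : σ →₀ ℕ} {U : Finset (σ →₀ ℕ)} {u : σ →₀ ℕ} {x : σ}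
    (hx : x ∉ V) (hcx : c x < u x) : avoiding V c U = avoiding V c (U.erase u) := by
  ext b
  refine ⟨fun hb => ⟨hb.1, fun v hv => hb.2 v (Finset.mem_of_mem_erase hv)⟩,
    fun hb => ⟨hb.1, fun v hv hvb => ?_⟩⟩
  by_cases h : v = u
  · subst h
    exact absurd (hvb x) (by rw [hb.1.2 x hx]; omega)
  · exact hb.2 v (Finset.mem_erase.2 ⟨h, hv⟩) hvb

theorem slice_update {V : Finset σ} {c : σ →₀ ℕ} {U : Finset (σ →₀ ℕ)} {x : σ} {j : ℕ}
    (hx : x ∈ V) (hj : c x ≤ j) :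
    {b ∈ avoiding V c U | b x = j} = avoiding (V.erase x) (c.update x j) U := by
  ext b
  simp only [avoiding, box, Set.mem_ofPred_eq, Finsupp.le_def, Finset.mem_erase, not_and]
  constructor
  · rintro ⟨⟨⟨h1, h2⟩, h3⟩, h4⟩
    refine ⟨⟨fun y => ?_, fun y hy => ?_⟩, h3⟩ <;> by_cases hyx : y = x
    · subst hyx; simp [h4]
    · simpa [Finsupp.update_apply, hyx] using h1 y
    · subst hyx; simp [h4]
    · simpa [Finsupp.update_apply, hyx] using h2 y (hy hyx)
  · rintro ⟨⟨h1, h2⟩, h3⟩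
    have h4 : b x = j := by simpa using h2 x (fun h => (h rfl).elim)
    refine ⟨⟨⟨fun y => ?_, fun y hy => ?_⟩, h3⟩, h4⟩
    · by_cases hyx : y = x
      · subst hyx; omega
      · simpa [Finsupp.update_apply, hyx] using h1 y
    · have hyx : y ≠ x := fun h => hy (h ▸ hx)
      simpa [Finsupp.update_apply, hyx] using h2 y (fun _ => hy)

theorem upper_update {V : Finset σ} {c : σ →₀ ℕ} {U : Finset (σ →₀ ℕ)} {x : σ} {j : ℕ}
    (hx : x ∈ V) (hj : c x ≤ j) :
    {b ∈ avoiding V c U | j ≤ b x} = avoiding V (c.update x j) U := by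
  ext b
  simp only [avoiding, box, Set.mem_ofPred_eq, Finsupp.le_def]
  constructor
  · rintro ⟨⟨⟨h1, h2⟩, h3⟩, h4⟩
    refine ⟨⟨fun y => ?_, fun y hy => ?_⟩, h3⟩
    · by_cases hyx : y = x
      · subst hyx; simpa using h4
      · simpa [Finsupp.update_apply, hyx] using h1 y
    · have hyx : y ≠ x := fun h => hy (h ▸ hx)
      simpa [Finsupp.update_apply, hyx] using h2 y hy
  · rintro ⟨⟨h1, h2⟩, h3⟩
    have h4 : j ≤ b x := by simpa using h1 x
    refine ⟨⟨⟨fun y => ?_, fun y hy => ?_⟩, h3⟩, h4⟩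
    · by_cases hyx : y = x
      · subst hyx; omega
      · simpa [Finsupp.update_apply, hyx] using h1 y
    · have hyx : y ≠ x := fun h => hy (h ▸ hx)
      simpa [Finsupp.update_apply, hyx] using h2 y hy

/-- Cutting along a coordinate `x`: finitely many slices below the level `d`, and the rest. -/
theorem BoxPartition.of_slices {k : ℕ} {V : Finset σ} {c : σ →₀ ℕ} {U : Finset (σ →₀ ℕ)} {x : σ}
    (hx : x ∈ V) {d : ℕ} (hd : c x ≤ d)
    (hs : ∀ j, c x ≤ j → j < d → BoxPartition k (avoiding (V.erase x) (c.update x j) U))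
    (hu : BoxPartition k (avoiding V (c.update x d) U)) : BoxPartition k (avoiding V c U) := by
  induction d, hd using Nat.le_induction with
  | base =>
    rwa [← upper_update hx le_rfl, Set.sep_eq_self_iff_mem_true.2 fun b hb => hb.1.1 x] at hu
  | succ d hd ih =>
    refine ih (fun j h1 h2 => hs j h1 (h2.trans d.lt_succ_self)) ?_
    have h := BoxPartition.union _ _ ?_ (hs d hd d.lt_succ_self) hu
    · convert h using 1
      rw [← upper_update hx hd, ← upper_update hx (hd.trans d.le_succ), ← slice_update hx hd]
      ext b
      simp only [Set.mem_ofPred_eq, Set.mem_union, ← and_or_left]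
      exact and_congr_right fun _ => by omega
    · rw [← slice_update hx hd, ← upper_update hx (hd.trans d.le_succ), Set.disjoint_left]
      rintro b ⟨-, h1⟩ ⟨-, h2⟩
      omega

variable [Fintype σ]

/-- Reduction principle: to decompose the vectors avoiding `U`, it suffices to treat the slices
orthogonal to the coordinates in which a given `u ∈ U` is not yet dominated by the base point. -/
theorem BoxPartition.of_mem {k : ℕ} {V : Finset σ} {U : Finset (σ →₀ ℕ)} {u : σ →₀ ℕ} (hu : u ∈ U)
    (c : σ →₀ ℕ)
    (herase : ∀ c', BoxPartition k (avoiding V c' (U.erase u)))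
    (hs : ∀ c' x, x ∈ V → c x < u x → c' x < u x → BoxPartition k (avoiding (V.erase x) c' U)) :
    BoxPartition k (avoiding V c U) := by
  -- Induction on the number of coordinates in which `c` is still below `u`: raising `c x` to `u x`
  -- removes one of them, and the points left behind form slices.
  induction hN : (Finset.univ.filter fun x => c x < u x).card using Nat.strong_induction_on
    generalizing c with
  | _ N ih =>
    by_cases huc : u ≤ c
    · rw [avoiding_eq_empty hu huc]; exact .empty
    obtain ⟨x, hx⟩ : ∃ x, c x < u x := by simpa [Finsupp.le_def] using huc
    by_cases hxV : x ∈ V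
    · refine .of_slices hxV hx.le (fun j _ h2 => hs _ x hxV hx (by simpa using h2)) ?_
      have hsub : (Finset.univ.filter fun y => (c.update x (u x)) y < u y) ⊂
          Finset.univ.filter fun y => c y < u y := by
        refine Finset.ssubset_iff_subset_ne.2 ⟨fun y hy => ?_, fun h => ?_⟩
        · by_cases hyx : y = x
          · subst hyx; simpa using hx
          · simpa [Finsupp.update_apply, hyx] using hy
        · have := h.symm ▸ Finset.mem_filter.2 ⟨Finset.mem_univ x, hx⟩
          simp at this
      refine ih _ (hN ▸ Finset.card_lt_card hsub) _ (fun c' y hy h1 h2 => hs c' y hy ?_ h2) rfl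
      by_cases hyx : y = x
      · subst hyx; exact hx
      · simpa [Finsupp.update_apply, hyx] using h1
    · rw [avoiding_erase hxV hx]
      exact herase c

/-- A slice at a level below `u x` loses the direction `x` but no longer has to avoid `u`, so the
difference between free directions and constraints is preserved. -/
theorem boxPartition_avoiding {k : ℕ} (U : Finset (σ →₀ ℕ)) (V : Finset σ) (c : σ →₀ ℕ)
    (h : k + U.card ≤ V.card) : BoxPartition k (avoiding V c U) := by
  induction U using Finset.induction_on generalizing V c with
  | empty => simpa [avoiding] using BoxPartition.of_box c V (by simpa using h)
  | insert u U huU ih =>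
    rw [Finset.card_insert_of_notMem huU] at h
    refine .of_mem (Finset.mem_insert_self u U) c (fun c' => ?_) fun c' x hxV _ hx => ?_
    · rw [Finset.erase_insert huU]
      exact ih V c' (by omega)
    · rw [avoiding_erase (Finset.notMem_erase x V) hx, Finset.erase_insert huU]
      refine ih _ c' ?_
      rw [Finset.card_erase_of_mem hxV]
      omega

/-- A slice below `u x` is also below `v x` for some `v ∈ U`: one lost direction pays for two
constraints, so `u` comes for free. -/
theorem boxPartition_avoiding_insert {k : ℕ} {U : Finset (σ →₀ ℕ)} {V : Finset σ}
    {u : σ →₀ ℕ} (huU : u ∉ U) {c : σ →₀ ℕ} (hdom : ∀ x, c x < u x → ∃ v ∈ U, u x ≤ v x)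
    (h : k + U.card ≤ V.card) : BoxPartition k (avoiding V c (insert u U)) := by
  refine .of_mem (Finset.mem_insert_self u U) c (fun c' => ?_) fun c' x hxV hcx hx => ?_
  · rw [Finset.erase_insert huU]
    exact boxPartition_avoiding U V c' h
  · obtain ⟨v, hv, huv⟩ := hdom x hcx
    rw [avoiding_erase (Finset.notMem_erase x V) hx, Finset.erase_insert huU,
      avoiding_erase (Finset.notMem_erase x V) (hx.trans_le huv)]
    refine boxPartition_avoiding _ _ c' ?_
    rw [Finset.card_erase_of_mem hxV, Finset.card_erase_of_mem hv]
    have := Finset.card_pos.2 ⟨x, hxV⟩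
    have := Finset.card_pos.2 ⟨v, hv⟩
    omega

theorem upperClosure_insert_eq (u : σ →₀ ℕ) (U : Finset (σ →₀ ℕ)) :
    {b | ∃ v ∈ insert u U, v ≤ b} =
      {b | ∃ v ∈ U, v ≤ b} ∪ avoiding Finset.univ u U := by
  ext b
  simp only [avoiding, box, Set.mem_ofPred_eq, Set.mem_union, Finset.mem_insert, Finset.mem_univ]
  grind

/-- Adding a generator `u` contributes the box at `u` minus what lies above `U`. This has `U.card`
constraints, one fewer than the number of generators, hence the `+ 1`. -/
theorem boxPartition_upperClosure {k : ℕ} (U : Finset (σ →₀ ℕ))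
    (h : k + U.card ≤ Fintype.card σ + 1) : BoxPartition k {b | ∃ u ∈ U, u ≤ b} := by
  induction U using Finset.induction_on with
  | empty => simpa using BoxPartition.empty
  | insert u U huU ih =>
    rw [Finset.card_insert_of_notMem huU] at h
    rw [upperClosure_insert_eq]
    exact .union _ _ (disjoint_avoiding u _ U) (ih (by omega))
      (boxPartition_avoiding U _ u (by rw [Finset.card_univ]; omega))

theorem boxPartition_upperClosure_insert {k : ℕ} {U : Finset (σ →₀ ℕ)} {u : σ →₀ ℕ}
    (huU : u ∉ U) (hU : U.Nonempty) (hdom : ∀ x, 0 < u x → ∃ v ∈ U, u x ≤ v x)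
    (h : k + U.card ≤ Fintype.card σ + 1) :
    BoxPartition k {b | ∃ v ∈ insert u U, v ≤ b} := by
  obtain ⟨w, hw⟩ := hU
  have hcard := Finset.card_erase_add_one hw
  have hu : u ∉ U.erase w := fun hu => huU (Finset.mem_of_mem_erase hu)
  -- Some `w ≠ u` is added last, so that `u` is a dominated constraint in the box at `w`. Where `w x
  -- < u x`, the dominating generator cannot be `w` itself.
  rw [← Finset.insert_erase hw, Finset.insert_comm, upperClosure_insert_eq]
  refine .union _ _ (disjoint_avoiding w _ _) (boxPartition_upperClosure _ ?_)
    (boxPartition_avoiding_insert hu (fun x hx => ?_) (by rw [Finset.card_univ]; omega))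
  · rw [Finset.card_insert_of_notMem hu]
    omega
  · obtain ⟨v, hv, huv⟩ := hdom x (by omega)
    exact ⟨v, Finset.mem_erase.2 ⟨fun h => by subst h; omega, hv⟩, huv⟩

end Boxes

/-! ### Commutative algebra: regular sequences and heights of associated primes -/

section AssociatedPrimes

open RingTheory.Sequence IsLocalRing Pointwise

universe u v

variable {R : Type u} [CommRing R] [IsNoetherianRing R]

theorem exists_associatedPrime_quotSMulTop [IsLocalRing R] {M : Type v} [AddCommGroup M]
    [Module R M] [Module.Finite R M] {P : Ideal R} (hP : P ∈ associatedPrimes R M) {x : R}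
    (hx : x ∈ maximalIdeal R) (hreg : IsSMulRegular M x) :
    ∃ Q ∈ associatedPrimes R (QuotSMulTop x M), P < Q := by
  obtain ⟨hPp, u, hu⟩ := isAssociatedPrime_iff.1 hP
  have hmem (r : R) : r ∈ P ↔ r • u = 0 := by
    rw [hu, Submodule.mem_colon_singleton, Submodule.mem_bot]
  have hu0 : u ≠ 0 := fun h => hPp.ne_top ((Ideal.eq_top_iff_one P).2 ((hmem 1).2 (by simp [h])))
  have hxP : x ∉ P := fun h => hu0 (hreg (by simpa using (hmem x).1 h))
  -- Let N be the submodule killed by `P`. If N ⊆ xM, regularity of `x` gives N ⊆ xN, so N = 0 by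
  -- Nakayama, contradicting `u ∈ N`. The class of `v` in M/xM is killed by both `P` and `x`.
  obtain ⟨v, hv, hvx⟩ : ∃ v ∈ Submodule.torsionBySet R M (P : Set R), v ∉ x • (⊤ : Submodule R M) := by
    by_contra! h
    have hle : Submodule.torsionBySet R M (P : Set R) ≤
        Ideal.span {x} • Submodule.torsionBySet R M (P : Set R) := by
      intro v hv
      obtain ⟨w, -, rfl⟩ := (Submodule.mem_smul_pointwise_iff_exists _ _ _).1 (h v hv)
      rw [Submodule.ideal_span_singleton_smul]
      refine Submodule.smul_mem_pointwise_smul _ _ _ ?_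
      rw [Submodule.mem_torsionBySet_iff] at hv ⊢
      intro p
      refine hreg ?_
      simpa [smul_comm x] using hv p
    have hbot := Submodule.eq_bot_of_le_smul_of_le_jacobson_bot _ _
      (IsNoetherian.noetherian _) hle
      (((Ideal.span_singleton_le_iff_mem _).2 hx).trans (maximalIdeal_le_jacobson ⊥))
    refine hu0 ((Submodule.mem_bot R).1 (hbot ▸ ?_))
    rw [Submodule.mem_torsionBySet_iff]
    exact fun p => (hmem p).1 p.2
  have hv0 : (Submodule.Quotient.mk v : QuotSMulTop x M) ≠ 0 := by
    rwa [Ne, Submodule.Quotient.mk_eq_zero]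
  obtain ⟨Q, hQ, hle⟩ := exists_le_isAssociatedPrime_of_isNoetherianRing R _ hv0
  refine ⟨Q, hQ, SetLike.lt_iff_le_and_exists.2 ⟨fun p hp => hle ?_, x, hle ?_, hxP⟩⟩
  · rw [Submodule.mem_colon_singleton, Submodule.mem_bot, ← Submodule.Quotient.mk_smul,
      (Submodule.mem_torsionBySet_iff _ _).1 hv ⟨p, hp⟩, Submodule.Quotient.mk_zero]
  · rw [Submodule.mem_colon_singleton, Submodule.mem_bot, ← Submodule.Quotient.mk_smul,
      Submodule.Quotient.mk_eq_zero]
    exact Submodule.smul_mem_pointwise_smul _ _ _ trivial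

/-- Each term of the sequence moves `P` to a strictly larger associated prime of the quotient, so
the height grows by at least one. -/
theorem length_add_height_le_of_isLocalRing [IsLocalRing R] (rs : List R) {M : Type v}
    [AddCommGroup M] [Module R M] [Module.Finite R M] (hrs : ∀ r ∈ rs, r ∈ maximalIdeal R)
    (hreg : IsWeaklyRegular M rs) {P : Ideal R} (hP : P ∈ associatedPrimes R M) :
    rs.length + P.height ≤ (maximalIdeal R).height := by
  induction rs generalizing M P with
  | nil => simpa using Ideal.height_mono (le_maximalIdeal hP.1.ne_top)
  | cons x rs ih =>
    rw [isWeaklyRegular_cons_iff] at hreg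
    obtain ⟨Q, hQ, hPQ⟩ := exists_associatedPrime_quotSMulTop hP (hrs x (by simp)) hreg.1
    have := hP.1
    have := hQ.1
    have h := ih (fun r hr => hrs r (by simp [hr])) hreg.2 hQ
    calc ((x :: rs).length : ℕ∞) + P.height = rs.length + (P.height + 1) := by
          rw [List.length_cons]; push_cast; ring
      _ ≤ rs.length + Q.height := by gcongr; exact Ideal.height_add_one_le_of_lt_of_isPrime hPQ
      _ ≤ _ := h

theorem length_add_height_le {𝔪 : Ideal R} [h𝔪 : 𝔪.IsPrime] (rs : List R) {M : Type v}
    [AddCommGroup M] [Module R M] [Module.Finite R M] (hrs : ∀ r ∈ rs, r ∈ 𝔪)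
    (hreg : IsWeaklyRegular M rs) {P : Ideal R} (hP : P ∈ associatedPrimes R M) (hle : P ≤ 𝔪) :
    rs.length + P.height ≤ 𝔪.height := by
  have := hP.1
  let S := Localization.AtPrime 𝔪
  have hdisj : Disjoint (𝔪.primeCompl : Set R) P :=
    Set.disjoint_left.2 fun r hr hrP => hr (hle hrP)
  have hreg' := IsWeaklyRegular.of_isLocalizedModule S 𝔪.primeCompl
    (LocalizedModule.mkLinearMap 𝔪.primeCompl M) hreg
  have hcomap : (P.map (algebraMap R S)).comap (algebraMap R S) = P :=
    IsLocalization.under_map_of_isPrime_disjoint 𝔪.primeCompl S ‹_› hdisj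
  have hPS := Module.associatedPrimes.mem_associatedPrimes_of_comap_mem_associatedPrimes_of_isLocalizedModule
    𝔪.primeCompl (LocalizedModule.mkLinearMap 𝔪.primeCompl M) (P.map (algebraMap R S))
    (by rwa [hcomap])
  have h := length_add_height_le_of_isLocalRing (rs.map (algebraMap R S)) (fun r hr => ?_) hreg' hPS
  · rwa [List.length_map, IsLocalization.height_map_of_disjoint 𝔪.primeCompl _ hdisj,
      ← IsLocalization.height_under 𝔪.primeCompl (maximalIdeal S),
      Localization.AtPrime.under_maximalIdeal] at h
  · obtain ⟨s, hs, rfl⟩ := List.mem_map.1 hr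
    exact (IsLocalization.AtPrime.to_map_mem_maximal_iff S 𝔪 s).2 (hrs s hs)

open CategoryTheory Abelian in
/-- If `M` admits a regular sequence of length `r + 1` in `𝔪`, then for any `M`-regular `y ∈ 𝔪`,
the quotient `M/yM` admits a regular sequence of length `r` in `𝔪`. -/
theorem exists_isRegular_quotSMulTop {R M : Type u} [CommRing R] [IsNoetherianRing R]
    [AddCommGroup M] [Module R M] [Module.Finite R M] {𝔪 : Ideal R} {y : R} (hy : y ∈ 𝔪)
    (hyreg : IsSMulRegular M y) (htop : 𝔪 • (⊤ : Submodule R M) < ⊤) {r : ℕ} {rs : List R}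
    (hlen : rs.length = r + 1) (hrs : ∀ x ∈ rs, x ∈ 𝔪) (hreg : IsRegular M rs) :
    ∃ ts : List R, ts.length = r ∧ (∀ x ∈ ts, x ∈ 𝔪) ∧ IsRegular (QuotSMulTop y M) ts := by
  have htop' : 𝔪 • (⊤ : Submodule R (QuotSMulTop y M)) < ⊤ := by
    refine lt_top_iff_ne_top.2 fun eq => ?_
    have h := congrArg (Submodule.comap (Submodule.mkQ _)) eq
    rw [Submodule.comap_smul_top_of_surjective 𝔪 _ (Submodule.mkQ_surjective _)] at h
    simp only [Submodule.ker_mkQ, Submodule.comap_top] at h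
    rw [← Submodule.ideal_span_singleton_smul, ← Submodule.sup_smul,
      sup_eq_left.2 ((Ideal.span_singleton_le_iff_mem _).2 hy)] at h
    exact htop.ne h
  have hex : ∃ rs : List R, rs.length = r + 1 ∧ (∀ x ∈ rs, x ∈ 𝔪) ∧
      IsRegular (ModuleCat.of R M) rs := ⟨rs, hlen, hrs, hreg⟩
  -- By Rees' criterion, regular sequences of length r + 1 amount to the vanishing of Ext^i(R/𝔪, M)
  -- for i ≤ r. The long exact sequence traps Ext^i(R/𝔪, M/yM) between degrees i and i + 1.
  have hExt := ((ModuleCat.exists_isRegular_tfae 𝔪 (r + 1) (ModuleCat.of R M) htop).out 3 1).1 hex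
  refine ((ModuleCat.exists_isRegular_tfae 𝔪 r (ModuleCat.of R (QuotSMulTop y M)) htop').out 1 3).1
    fun i hi => ?_
  have zero1 := AddCommGrpCat.isZero_of_iff_subsingleton.mpr (hExt i (by omega))
  have zero2 := AddCommGrpCat.isZero_of_iff_subsingleton.mpr (hExt (i + 1) (by omega))
  exact AddCommGrpCat.subsingleton_of_isZero <| ShortComplex.Exact.isZero_of_both_zeros
    ((Ext.covariant_sequence_exact₃' (ModuleCat.of R (Shrink.{u} (R ⧸ 𝔪)))
      (IsSMulRegular.smulShortComplex_shortExact (M := ModuleCat.of R M) hyreg)) i (i + 1) rfl)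
    (zero1.eq_zero_of_src _) (zero2.eq_zero_of_tgt _)

end AssociatedPrimes

/-! ### Upper bounds for the depth of S/I and of I -/

section DepthBounds

open MvPolynomial Pointwise

universe u

variable {K : Type u} [Field K] {n : ℕ}

theorem isPrime_span_X_image (C : Set (Fin n)) :
    (Ideal.span (X '' C : Set (PolyRing K n))).IsPrime := by
  classical
  let φ : PolyRing K n →ₐ[K] PolyRing K n := aeval fun i => if i ∈ C then 0 else X i
  have hφ : Ideal.span (X '' C : Set (PolyRing K n)) = RingHom.ker φ := by
    -- Modulo the variables in `C`, the substitution `φ` is the identity, so its kernel lies in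
    -- their span.
    refine le_antisymm (Ideal.span_le.2 ?_) fun f hf => ?_
    · rintro _ ⟨i, hi, rfl⟩
      simp [φ, RingHom.mem_ker, hi]
    · have h : (Ideal.Quotient.mkₐ K (Ideal.span (X '' C : Set (PolyRing K n)))).comp φ =
          Ideal.Quotient.mkₐ K _ := by
        refine MvPolynomial.algHom_ext fun i => ?_
        by_cases hi : i ∈ C
        · have : (X i : PolyRing K n) ∈ Ideal.span (X '' C : Set (PolyRing K n)) :=
            Ideal.subset_span ⟨i, hi, rfl⟩
          simp [φ, hi, Ideal.Quotient.eq_zero_iff_mem.2 this]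
        · simp [φ, hi]
      have h2 := DFunLike.congr_fun h f
      rw [AlgHom.comp_apply, (RingHom.mem_ker).1 hf, map_zero] at h2
      exact Ideal.Quotient.eq_zero_iff_mem.1 h2.symm
  rw [hφ]
  exact RingHom.ker_isPrime _

theorem card_le_height_span_X_image (C : Finset (Fin n)) :
    (C.card : ℕ∞) ≤ (Ideal.span (X '' (C : Set (Fin n)) : Set (PolyRing K n))).height := by
  induction C using Finset.induction_on with
  | empty => simp
  | insert x C hx ih =>
    have h1 := isPrime_span_X_image (K := K) (C : Set (Fin n))
    have h2 := isPrime_span_X_image (K := K) ((insert x C : Finset (Fin n)) : Set (Fin n))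
    have hlt : Ideal.span (X '' (C : Set (Fin n)) : Set (PolyRing K n)) <
        Ideal.span (X '' ((insert x C : Finset (Fin n)) : Set (Fin n)) : Set (PolyRing K n)) := by
      refine SetLike.lt_iff_le_and_exists.2
        ⟨Ideal.span_mono (Set.image_mono (by simp)), X x, Ideal.subset_span ⟨x, by simp, rfl⟩, ?_⟩
      rw [mem_ideal_span_X_image]
      intro h
      obtain ⟨i, hi, hi'⟩ := h (Finsupp.single x 1) (by simp [support_X])
      rw [Finsupp.single_apply_ne_zero] at hi'
      exact hx (hi'.1 ▸ hi)
    rw [Finset.card_insert_of_notMem hx, Nat.cast_add_one]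
    exact (add_le_add_left ih 1).trans (Ideal.height_add_one_le_of_lt_of_isPrime hlt)

theorem gradedMaximalIdeal_eq :
    gradedMaximalIdeal K n = Ideal.span (X '' (Set.univ : Set (Fin n))) := by
  rw [Set.image_univ]; rfl

instance : (gradedMaximalIdeal K n).IsPrime :=
  gradedMaximalIdeal_eq (K := K) (n := n) ▸ isPrime_span_X_image _

theorem height_gradedMaximalIdeal_le : (gradedMaximalIdeal K n).height ≤ n := by
  have h := Ideal.height_le_ringKrullDim_of_isPrime (I := gradedMaximalIdeal K n)
  rw [MvPolynomial.ringKrullDim_of_isNoetherianRing, ringKrullDim_eq_zero_of_field] at h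
  exact WithBot.coe_le_coe.1 (by simpa using h)

theorem mem_gradedMaximalIdeal_iff {f : PolyRing K n} :
    f ∈ gradedMaximalIdeal K n ↔ coeff 0 f = 0 := by
  rw [gradedMaximalIdeal_eq, mem_ideal_span_X_image]
  constructor
  · intro h
    by_contra h0
    obtain ⟨i, -, hi⟩ := h 0 (mem_support_iff.2 h0)
    simp at hi
  · intro h m hm
    by_contra! h0
    have : m = 0 := Finsupp.ext fun i => h0 i trivial
    exact mem_support_iff.1 hm (this ▸ h)

theorem depth_quotient_add_height_le {I P : Ideal (PolyRing K n)}
    (hP : P ∈ associatedPrimes (PolyRing K n) (PolyRing K n ⧸ I))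
    (hle : P ≤ gradedMaximalIdeal K n) : depth K n (PolyRing K n ⧸ I) + P.height ≤ n := by
  rw [depth, ENat.iSup_add]
  refine iSup_le fun rs => ?_
  by_cases h1 : ∀ r ∈ rs, r ∈ gradedMaximalIdeal K n
  · by_cases h2 : RingTheory.Sequence.IsRegular (PolyRing K n ⧸ I) rs
    · rw [iSup_pos h1, iSup_pos h2]
      exact (length_add_height_le rs h1 h2.1 hP hle).trans height_gradedMaximalIdeal_le
    -- An inadmissible sequence contributes 0 to the supremum, leaving only ht P ≤ n.
    · simpa [h2] using (Ideal.height_mono hle).trans height_gradedMaximalIdeal_le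
  · rw [iSup_neg h1]
    simpa using (Ideal.height_mono hle).trans height_gradedMaximalIdeal_le

theorem smul_top_lt_top {I : Ideal (PolyRing K n)} (hI : I ≠ ⊥) :
    gradedMaximalIdeal K n • (⊤ : Submodule (PolyRing K n) I) < ⊤ := by
  refine lt_top_iff_ne_top.2 fun h => ?_
  obtain ⟨r, hr, hr0⟩ := Submodule.exists_sub_one_mem_and_smul_eq_zero_of_fg_of_le_smul
    (gradedMaximalIdeal K n) (⊤ : Submodule (PolyRing K n) I) (IsNoetherian.noetherian _) h.ge
  obtain ⟨f, hf, hf0⟩ := Submodule.exists_mem_ne_zero_of_ne_bot hI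
  have hrf : r * f = 0 := congrArg Subtype.val (hr0 ⟨f, hf⟩ trivial)
  obtain rfl := (mul_eq_zero.1 hrf).resolve_right hf0
  rw [mem_gradedMaximalIdeal_iff] at hr
  simp at hr

/-- If P is the annihilator of the class of w, then yw lies in I and, S being a domain, r(yw) ∈ yI
exactly when rw ∈ I. -/
theorem mem_associatedPrimes_quotSMulTop {I P : Ideal (PolyRing K n)}
    (hP : P ∈ associatedPrimes (PolyRing K n) (PolyRing K n ⧸ I)) {y : PolyRing K n} (hy : y ∈ P)
    (hy0 : y ≠ 0) : P ∈ associatedPrimes (PolyRing K n) (QuotSMulTop y I) := by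
  obtain ⟨hPp, u, hu⟩ := isAssociatedPrime_iff.1 hP
  obtain ⟨w, rfl⟩ := Ideal.Quotient.mk_surjective u
  have hmem (r : PolyRing K n) : r ∈ P ↔ r * w ∈ I := by
    rw [hu, Submodule.mem_colon_singleton, Submodule.mem_bot, ← Ideal.Quotient.eq_zero_iff_mem]
    rfl
  refine isAssociatedPrime_iff.2 ⟨hPp, Submodule.Quotient.mk ⟨y * w, (hmem y).1 hy⟩, ?_⟩
  ext r
  rw [hmem, Submodule.mem_colon_singleton, Submodule.mem_bot, ← Submodule.Quotient.mk_smul,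
    Submodule.Quotient.mk_eq_zero, Submodule.mem_smul_pointwise_iff_exists]
  constructor
  · exact fun h => ⟨⟨r * w, h⟩, trivial, Subtype.ext (by simp; ring)⟩
  · rintro ⟨z, -, hz⟩
    have hz' : y * (z : PolyRing K n) = r * (y * w) := congrArg Subtype.val hz
    have : (z : PolyRing K n) = r * w := mul_left_cancel₀ hy0 (by rw [hz']; ring)
    exact this ▸ z.2

/-- A nonzero y in I is regular on I and lies in P. Passing to I/yI costs one term of the sequence
and keeps P associated, which accounts for the `+ 1`. -/
theorem depth_ideal_add_height_le {I P : Ideal (PolyRing K n)} (hI : I ≠ ⊥)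
    (hP : P ∈ associatedPrimes (PolyRing K n) (PolyRing K n ⧸ I))
    (hle : P ≤ gradedMaximalIdeal K n) : depth K n I + P.height ≤ n + 1 := by
  have hn : P.height ≤ n := (Ideal.height_mono hle).trans height_gradedMaximalIdeal_le
  rw [depth, ENat.iSup_add]
  refine iSup_le fun rs => ?_
  by_cases h1 : ∀ r ∈ rs, r ∈ gradedMaximalIdeal K n
  · by_cases h2 : RingTheory.Sequence.IsRegular I rs
    · rw [iSup_pos h1, iSup_pos h2]
      rcases hlen : rs.length with _ | r
      · simpa using hn.trans le_self_add
      · obtain ⟨y, hy, hy0⟩ := Submodule.exists_mem_ne_zero_of_ne_bot hI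
        have hyP : y ∈ P := by
          have := hP.annihilator_le
          rw [Submodule.annihilator_top, Ideal.annihilator_quotient] at this
          exact this hy
        have hyreg : IsSMulRegular I y := fun a b hab => by
          have : y * (a : PolyRing K n) = y * b := congrArg Subtype.val hab
          exact Subtype.ext (mul_left_cancel₀ hy0 this)
        obtain ⟨ts, hts, hmem, hreg⟩ := exists_isRegular_quotSMulTop (hle hyP) hyreg
          (smul_top_lt_top hI) hlen h1 h2
        have h := (length_add_height_le ts hmem hreg.1
          (mem_associatedPrimes_quotSMulTop hP hyP hy0) hle).trans height_gradedMaximalIdeal_le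
        rw [hts] at h
        calc ((r + 1 : ℕ) : ℕ∞) + P.height = (r + P.height) + 1 := by push_cast; ring
          _ ≤ n + 1 := by gcongr
    · simpa [h2] using hn.trans le_self_add
  · rw [iSup_neg h1]
    simpa using hn.trans le_self_add

end DepthBounds

/-! ### From box partitions to Stanley decompositions -/

section Decompositions

open MvPolynomial

variable {K : Type*} [Field K] {n : ℕ}

section Module

variable {M : Type*} [AddCommGroup M] [Module (PolyRing K n) M] [Module K M]
  [IsScalarTower K (PolyRing K n) M] {e : (Fin n →₀ ℕ) → M} {A : Set (Fin n →₀ ℕ)}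

theorem add_mem_box {f : PolyRing K n} {Z : Finset (Fin n)}
    (hf : f ∈ supported K (Z : Set (Fin n))) (a : Fin n →₀ ℕ) {c : Fin n →₀ ℕ}
    (hc : c ∈ f.support) : a + c ∈ box a Z := by
  refine ⟨le_self_add, fun x hx => ?_⟩
  by_contra h
  have hcx : x ∈ c.support := by
    rw [Finsupp.mem_support_iff]
    intro h0
    exact h (by simp [h0])
  exact hx (mem_supported.1 hf ((mem_vars_iff_mem_support x).2 ⟨c, hc, hcx⟩))

variable (hmul : ∀ a ∈ A, ∀ c, a + c ∈ A → monomial c (1 : K) • e a = e (a + c))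
include hmul

theorem smul_eq_sum {a : Fin n →₀ ℕ} {Z : Finset (Fin n)} (haZ : box a Z ⊆ A)
    {f : PolyRing K n} (hf : f ∈ supported K (Z : Set (Fin n))) :
    f • e a = ∑ c ∈ f.support, coeff c f • e (a + c) := by
  conv_lhs => rw [← support_sum_monomial_coeff f, Finset.sum_smul]
  refine Finset.sum_congr rfl fun c hc => ?_
  rw [← hmul a (haZ ⟨le_rfl, fun _ _ => rfl⟩) c (haZ (add_mem_box hf a hc)), ← smul_assoc,
    smul_monomial, smul_eq_mul, mul_one]

theorem stanleySpace_eq_span {a : Fin n →₀ ℕ} {Z : Finset (Fin n)} (haZ : box a Z ⊆ A) :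
    stanleySpace K (e a) Z = Submodule.span K (e '' box a Z) := by
  refine le_antisymm ?_ (Submodule.span_le.2 ?_)
  · rintro _ ⟨f, hf, rfl⟩
    change f • e a ∈ _
    rw [smul_eq_sum hmul haZ hf]
    exact Submodule.sum_mem _ fun c hc => Submodule.smul_mem _ _
      (Submodule.subset_span ⟨_, add_mem_box hf a hc, rfl⟩)
  · rintro _ ⟨b, hb, rfl⟩
    have hab : a + (b - a) = b := add_tsub_cancel_of_le hb.1
    refine ⟨monomial (b - a) 1, ?_, ?_⟩
    · change monomial (b - a) 1 ∈ supported K (Z : Set (Fin n))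
      rw [mem_supported, vars_monomial one_ne_zero]
      intro x hx
      by_contra hxZ
      have := hb.2 x hxZ
      simp [this] at hx
    · change monomial (b - a) (1 : K) • e a = e b
      rw [hmul a (haZ ⟨le_rfl, fun _ _ => rfl⟩) _ (hab.symm ▸ haZ hb), hab]

/-- A partition into boxes of the exponents of a monomial `K`-basis of `M` gives a Stanley
decomposition of `M`. -/
theorem le_sdepth_of_boxPartition {𝒜 : (Fin n → ℤ) → Submodule K M} {k : ℕ}
    (hA : BoxPartition k A) (hli : LinearIndepOn K e A) (hspan : Submodule.span K (e '' A) = ⊤)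
    (hhom : ∀ a ∈ A, ∃ d, e a ∈ 𝒜 d) : (k : ℕ∞) ≤ sdepth 𝒜 := by
  obtain ⟨r, a, Z, hk, hU, hdisj⟩ := hA.exists_family
  have hsub (i) : box (a i) (Z i) ⊆ A := hU ▸ Set.subset_iUnion (fun i => box (a i) (Z i)) i
  have ha (i) : a i ∈ A := hsub i ⟨le_rfl, fun _ _ => rfl⟩
  have himage {B : Set (Fin n →₀ ℕ)} (hB : B ⊆ A) :
      e '' B = (fun b : A => e b) '' (Subtype.val ⁻¹' B) := by
    rw [← Function.comp_def, Set.image_comp, Subtype.image_preimage_coe, Set.inter_eq_right.2 hB]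
  have hspace (i) : stanleySpace K (e (a i)) (Z i) = Submodule.span K (e '' box (a i) (Z i)) :=
    stanleySpace_eq_span hmul (hsub i)
  let D : StanleyDecomposition 𝒜 :=
    { r := r
      m := fun i => e (a i)
      Z := Z
      homogeneous := fun i => hhom _ (ha i)
      free := fun i f hf h0 => by
        rw [smul_eq_sum hmul (hsub i) hf] at h0
        have hli' : LinearIndepOn K (fun c => e (a i + c)) (f.support : Set (Fin n →₀ ℕ)) :=
          LinearIndependent.comp hli
            (fun c : (f.support : Set (Fin n →₀ ℕ)) =>
              ⟨a i + c, hsub i (add_mem_box hf (a i) c.2)⟩)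
            fun c d h => Subtype.ext (add_left_cancel (congrArg Subtype.val h))
        have h1 := linearIndepOn_finset_iff.1 hli' (fun c => coeff c f) h0
        ext c
        by_cases hc : c ∈ f.support
        · simpa using h1 c hc
        · simpa using hc
      isInternal := by
        rw [DirectSum.isInternal_submodule_iff_iSupIndep_and_iSup_eq_top]
        simp only [hspace]
        constructor
        · intro i
          beta_reduce
          rw [← Submodule.span_iUnion₂, ← Set.image_iUnion₂, himage (hsub i),
            himage (Set.iUnion₂_subset fun j _ => hsub j)]
          refine LinearIndependent.disjoint_span_image hli (Disjoint.preimage _ ?_)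
          rw [Set.disjoint_iUnion₂_right]
          exact fun j hj => hdisj hj.symm
        · rw [← Submodule.span_iUnion, ← Set.image_iUnion, hU, hspan] }
  exact (le_iInf fun i => by exact_mod_cast hk i : (k : ℕ∞) ≤ D.sdepth).trans
    (le_iSup (fun D : StanleyDecomposition 𝒜 => D.sdepth) D)

end Module

theorem monomial_mem_multigrading (b : Fin n →₀ ℕ) :
    monomial b (1 : K) ∈ multigrading K n fun i => (b i : ℤ) := by
  refine isWeightedHomogeneous_monomial _ _ _ ?_
  rw [Finsupp.weight_apply, Finsupp.sum_fintype _ _ (by simp)]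
  ext i
  simp [Finset.sum_apply, Pi.single_apply]

variable {I : Ideal (PolyRing K n)}

theorem IsMonomialIdeal.mem_iff (hI : IsMonomialIdeal I) {f : PolyRing K n} :
    f ∈ I ↔ ∀ b ∈ f.support, monomial b (1 : K) ∈ I := by
  obtain ⟨A, rfl⟩ := hI
  simp [mem_ideal_span_monomial_image]

theorem le_sdepth_quotientGrading (hI : IsMonomialIdeal I) {k : ℕ}
    (h : BoxPartition k {b | monomial b (1 : K) ∉ I}) :
    (k : ℕ∞) ≤ sdepth (quotientGrading I) := by
  classical
  let e : (Fin n →₀ ℕ) → PolyRing K n ⧸ I := fun b => Ideal.Quotient.mk I (monomial b 1)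
  have hmk (c : K) (b : Fin n →₀ ℕ) : c • e b = Ideal.Quotient.mk I (monomial b c) := by
    change Ideal.Quotient.mk I (c • monomial b 1) = _
    rw [smul_monomial, smul_eq_mul, mul_one]
  refine le_sdepth_of_boxPartition (e := e) (fun a _ c _ => ?_) h ?_ ?_ fun a _ => ?_
  · change Ideal.Quotient.mk I (monomial c 1 * monomial a 1) = _
    rw [monomial_mul, mul_one, add_comm]
  · rw [linearIndepOn_iff']
    intro s g hs h0 b hb
    simp only [hmk, ← map_sum] at h0
    rw [Ideal.Quotient.eq_zero_iff_mem, hI.mem_iff] at h0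
    by_contra hg
    refine hs hb (h0 b ?_)
    simpa [mem_support_iff, coeff_sum, coeff_monomial, hb] using hg
  · rw [eq_top_iff]
    rintro x -
    obtain ⟨f, rfl⟩ := Ideal.Quotient.mk_surjective x
    rw [← support_sum_monomial_coeff f, map_sum]
    refine Submodule.sum_mem _ fun b _ => ?_
    rw [← hmk]
    refine Submodule.smul_mem _ _ ?_
    by_cases hb : monomial b (1 : K) ∈ I
    · simp [e, Ideal.Quotient.eq_zero_iff_mem.2 hb]
    · exact Submodule.subset_span ⟨b, hb, rfl⟩
  · exact ⟨_, Submodule.mem_map_of_mem (monomial_mem_multigrading a)⟩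

theorem le_sdepth_idealGrading (hI : IsMonomialIdeal I) {k : ℕ}
    (h : BoxPartition k {b | monomial b (1 : K) ∈ I}) :
    (k : ℕ∞) ≤ sdepth (idealGrading I) := by
  classical
  -- The default value 0 plays no role: `e` is only considered on exponents of monomials in I.
  let e : (Fin n →₀ ℕ) → I := fun b => if hb : monomial b (1 : K) ∈ I then ⟨_, hb⟩ else 0
  have he {b : Fin n →₀ ℕ} (hb : monomial b (1 : K) ∈ I) : (e b : PolyRing K n) = monomial b 1 := by
    simp [e, hb]
  refine le_sdepth_of_boxPartition (e := e) (fun a ha c hc => ?_) h ?_ ?_ fun a ha => ?_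
  · refine Subtype.ext ?_
    rw [Submodule.coe_smul, he ha, he hc, smul_eq_mul, monomial_mul, mul_one, add_comm]
  · rw [linearIndepOn_iff']
    intro s g hs h0 b hb
    have h1 := congrArg (fun z : I => coeff b (z : PolyRing K n)) h0
    simp only [Submodule.coe_sum, coeff_sum] at h1
    rw [Finset.sum_eq_single b (fun c hc hcb => ?_) (fun hb' => (hb' hb).elim)] at h1
    · change coeff b (g b • (e b : PolyRing K n)) = _ at h1
      simpa [he (hs hb)] using h1
    · change coeff b (g c • (e c : PolyRing K n)) = _
      simp [he (hs hc), coeff_monomial, hcb]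
  · rw [eq_top_iff]
    rintro ⟨f, hf⟩ -
    have hfs : (⟨f, hf⟩ : I) = ∑ b ∈ f.support, coeff b f • e b := by
      refine Subtype.ext ?_
      rw [Submodule.coe_sum]
      refine (support_sum_monomial_coeff f).symm.trans (Finset.sum_congr rfl fun b hb => ?_)
      change _ = coeff b f • (e b : PolyRing K n)
      rw [he (hI.mem_iff.1 hf b hb), smul_monomial, smul_eq_mul, mul_one]
    rw [hfs]
    exact Submodule.sum_mem _ fun b hb => Submodule.smul_mem _ _
      (Submodule.subset_span ⟨b, hI.mem_iff.1 hf b hb, rfl⟩)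
  · refine ⟨fun i => a i, ?_⟩
    change (e a : PolyRing K n) ∈ multigrading K n _
    rw [he ha]
    exact monomial_mem_multigrading a

end Decompositions

/-! ### Minimal monomial generators and an explicit associated prime -/

section MinimalGenerators

open MvPolynomial

universe u

variable {K : Type u} [Field K] {n : ℕ} {I : Ideal (PolyRing K n)}

theorem monomial_mem_of_le {a b : Fin n →₀ ℕ} (hab : a ≤ b) (ha : monomial a (1 : K) ∈ I) :
    monomial b (1 : K) ∈ I := by
  have h := I.mul_mem_left (monomial (b - a) 1) ha
  rwa [monomial_mul, mul_one, tsub_add_cancel_of_le hab] at h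

theorem finite_minimal_exponents (I : Ideal (PolyRing K n)) :
    {b | Minimal (fun b => monomial b (1 : K) ∈ I) b}.Finite :=
  WellQuasiOrderedLE.finite_of_isAntichain (setOfPred_minimal_antichain _)

/-- The exponents of the minimal monomial generators of a monomial ideal. -/
def minimalExponents (I : Ideal (PolyRing K n)) : Finset (Fin n →₀ ℕ) :=
  (finite_minimal_exponents I).toFinset

theorem mem_minimalExponents {b : Fin n →₀ ℕ} :
    b ∈ minimalExponents I ↔ Minimal (fun b => monomial b (1 : K) ∈ I) b := by
  simp [minimalExponents]

theorem monomial_mem_iff {b : Fin n →₀ ℕ} :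
    monomial b (1 : K) ∈ I ↔ ∃ u ∈ minimalExponents I, u ≤ b := by
  constructor
  · intro h
    obtain ⟨u, hub, hu⟩ := exists_minimal_le_of_wellFoundedLT
      (fun b => monomial b (1 : K) ∈ I) b h
    exact ⟨u, mem_minimalExponents.2 hu, hub⟩
  · rintro ⟨u, hu, hub⟩
    exact monomial_mem_of_le hub (mem_minimalExponents.1 hu).1

/-- A monomial of `f` dividing the minimal one lies in I, hence equals it, so only the constant term
of `p` contributes. -/
theorem coeff_mul_of_minimal (hI : IsMonomialIdeal I) {g : Fin n →₀ ℕ}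
    (hg : g ∈ minimalExponents I) {f : PolyRing K n} (hf : f ∈ I) (p : PolyRing K n) :
    coeff g (p * f) = coeff 0 p * coeff g f := by
  classical
  rw [coeff_mul]
  refine Finset.sum_eq_single (0, g) (fun x hx hne => ?_) fun h => ?_
  · obtain ⟨a, b⟩ := x
    rw [Finset.HasAntidiagonal.mem_antidiagonal] at hx
    dsimp only at hx ⊢
    by_cases hb : coeff b f = 0
    · rw [hb, mul_zero]
    · have hbI := hI.mem_iff.1 hf b (mem_support_iff.2 hb)
      have hbg : b = g := (mem_minimalExponents.1 hg).eq_of_le hbI (hx ▸ le_add_self)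
      subst hbg
      have ha : a = 0 := by simpa using hx
      exact (hne (by rw [ha])).elim
  · simp at h

/-- Reading off coefficients at the minimal exponents maps I onto K^G, and `p • f` goes to `coeff 0
p` times the image of `f`. Any generating set of I therefore has image spanning K^G. -/
theorem card_minimalExponents_le (hI : IsMonomialIdeal I) :
    (minimalExponents I).card ≤ Submodule.spanFinrank I := by
  classical
  have hfg : I.FG := IsNoetherian.noetherian I
  let G := minimalExponents I
  let φ : PolyRing K n →ₗ[K] (G → K) := LinearMap.pi fun g => lcoeff K g.1
  have hφ (f : PolyRing K n) (g : G) : φ f g = coeff g.1 f := rfl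
  let s := (Submodule.FG.finite_generators hfg).toFinset
  have hmem {f : PolyRing K n} (hf : f ∈ I) :
      φ f ∈ Submodule.span K ((s.image φ : Finset (G → K)) : Set (G → K)) := by
    rw [← Submodule.span_generators I] at hf
    induction hf using Submodule.span_induction with
    | mem x hx => exact Submodule.subset_span (by simpa [s] using ⟨x, hx, rfl⟩)
    | zero => simp
    | add x y _ _ hx hy => rw [map_add]; exact Submodule.add_mem _ hx hy
    | smul p x hx ih =>
      rw [Submodule.span_generators I] at hx
      have h : φ (p • x) = coeff 0 p • φ x := by
        ext g
        exact coeff_mul_of_minimal hI g.2 hx p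
      rw [h]
      exact Submodule.smul_mem _ _ ih
  have htop : Submodule.span K ((s.image φ : Finset (G → K)) : Set (G → K)) = ⊤ := by
    rw [eq_top_iff, ← (Pi.basisFun K G).span_eq, Submodule.span_le]
    rintro _ ⟨g, rfl⟩
    have hg : Pi.basisFun K G g = φ (monomial g.1 1) := by
      ext g'
      rw [Pi.basisFun_apply, hφ, coeff_monomial, Pi.single_apply]
      exact if_congr (by rw [eq_comm, Subtype.ext_iff]) rfl rfl
    rw [hg]
    exact hmem (mem_minimalExponents.1 g.2).1
  have h := finrank_span_finset_le_card (R := K) (s.image φ)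
  rw [Set.finrank, htop, finrank_top, Module.finrank_fintype_fun_eq_card, Fintype.card_coe] at h
  refine h.trans (Finset.card_image_le.trans ?_)
  rw [← Submodule.FG.generators_ncard hfg, Set.ncard_eq_toFinset_card _
    (Submodule.FG.finite_generators hfg)]

theorem zero_notMem_minimalExponents (hI : I ≠ ⊤) : (0 : Fin n →₀ ℕ) ∉ minimalExponents I :=
  fun h => hI ((Ideal.eq_top_iff_one I).2 (mem_minimalExponents.1 h).1)

theorem le_gradedMaximalIdeal (hI : IsMonomialIdeal I) (htop : I ≠ ⊤) :
    I ≤ gradedMaximalIdeal K n := fun f hf => by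
  rw [mem_gradedMaximalIdeal_iff]
  by_contra h
  exact htop ((Ideal.eq_top_iff_one I).2 (hI.mem_iff.1 hf 0 (mem_support_iff.2 h)))

theorem exists_associatedPrime_height_le (hI : IsMonomialIdeal I) (htop : I ≠ ⊤) :
    ∃ P ∈ associatedPrimes (PolyRing K n) (PolyRing K n ⧸ I),
      P ≤ gradedMaximalIdeal K n ∧ I.height ≤ P.height := by
  obtain ⟨P, hP, hle⟩ := Ideal.exists_minimalPrimes_le (le_gradedMaximalIdeal hI htop)
  refine ⟨P, Module.associatedPrimes.minimalPrimes_annihilator_subset_associatedPrimes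
    (PolyRing K n) (PolyRing K n ⧸ I) ?_, hle, Ideal.height_mono hP.1.2⟩
  rwa [Ideal.annihilator_quotient]

/-- If every minimal generator has a variable in which its exponent is strictly larger than that of
all the others, then these variables generate an associated prime of `S/I`. -/
theorem span_X_image_mem_associatedPrimes (hI : IsMonomialIdeal I) {x : (Fin n →₀ ℕ) → Fin n}
    (hpos : ∀ u ∈ minimalExponents I, 0 < u (x u))
    (hx : ∀ u ∈ minimalExponents I, ∀ v ∈ minimalExponents I, v ≠ u → v (x u) < u (x u)) :
    Ideal.span (X '' ((minimalExponents I).image x : Set (Fin n)) : Set (PolyRing K n)) ∈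
      associatedPrimes (PolyRing K n) (PolyRing K n ⧸ I) := by
  classical
  let G := minimalExponents I
  -- The lcm of the generators divided by the product of the chosen variables. Each generator `u`
  -- exceeds `w` only at `x u`, and there by exactly one, so the monomials carrying `w` into I are
  -- those divisible by a chosen variable.
  let w : Fin n →₀ ℕ := Finsupp.equivFunOnFinite.symm fun y =>
    if y ∈ G.image x then (G.sup fun u => u y) - 1 else G.sup fun u => u y
  have hsup {u} (hu : u ∈ G) : (G.sup fun v => v (x u)) = u (x u) := by
    refine le_antisymm (Finset.sup_le fun v hv => ?_)
      (Finset.le_sup (f := fun v : Fin n →₀ ℕ => v (x u)) hu)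
    by_cases h : v = u
    · rw [h]
    · exact (hx u hu v hv h).le
  have hw {u} (hu : u ∈ G) : w (x u) = u (x u) - 1 := by
    have : x u ∈ G.image x := Finset.mem_image_of_mem x hu
    rw [← hsup hu]
    simp only [w, Finsupp.equivFunOnFinite_symm_apply_apply, this, if_true]
  have hw' {u} (hu : u ∈ G) {y : Fin n} (hy : y ≠ x u) : u y ≤ w y := by
    by_cases hyG : y ∈ G.image x
    · obtain ⟨v, hv, rfl⟩ := Finset.mem_image.1 hyG
      rw [hw hv]
      have := hx v hv u hu (fun h => hy (by rw [h]))
      omega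
    · simp only [w, Finsupp.equivFunOnFinite_symm_apply_apply, hyG, if_false]
      exact Finset.le_sup (f := fun v : Fin n →₀ ℕ => v y) hu
  refine isAssociatedPrime_iff.2 ⟨isPrime_span_X_image _, Ideal.Quotient.mk I (monomial w 1), ?_⟩
  refine le_antisymm (Ideal.span_le.2 ?_) fun r hr => ?_
  · rintro _ ⟨y, hy, rfl⟩
    obtain ⟨u, hu, rfl⟩ := Finset.mem_image.1 (Finset.mem_coe.1 hy)
    rw [SetLike.mem_coe, Submodule.mem_colon_singleton, Submodule.mem_bot]
    change Ideal.Quotient.mk I (monomial (Finsupp.single (x u) 1) 1 * monomial w 1) = 0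
    rw [Ideal.Quotient.eq_zero_iff_mem, monomial_mul, mul_one, monomial_mem_iff]
    refine ⟨u, hu, fun y => ?_⟩
    by_cases hy : y = x u
    · subst hy
      rw [Finsupp.add_apply, Finsupp.single_eq_same, hw hu]
      omega
    · exact (hw' hu hy).trans (by simp)
  · rw [Submodule.mem_colon_singleton, Submodule.mem_bot] at hr
    change Ideal.Quotient.mk I (r * monomial w 1) = 0 at hr
    rw [Ideal.Quotient.eq_zero_iff_mem] at hr
    rw [mem_ideal_span_X_image]
    intro b hb
    have hbw : monomial (b + w) (1 : K) ∈ I := by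
      refine hI.mem_iff.1 hr _ (mem_support_iff.2 ?_)
      rw [coeff_mul_monomial, mul_one]
      exact mem_support_iff.1 hb
    obtain ⟨u, hu, hub⟩ := monomial_mem_iff.1 hbw
    refine ⟨x u, Finset.mem_coe.2 (Finset.mem_image_of_mem x hu), fun h0 => ?_⟩
    have h1 := hub (x u)
    have h2 := hpos u hu
    rw [Finsupp.add_apply, h0, hw hu] at h1
    omega

end MinimalGenerators

/-! ### The two cases of the dichotomy -/

section AlmostCompleteIntersection

open MvPolynomial

universe u

variable {K : Type u} [Field K] {n : ℕ} {I : Ideal (PolyRing K n)}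

theorem setOf_monomial_notMem_eq_avoiding :
    {b | monomial b (1 : K) ∉ I} = avoiding Finset.univ 0 (minimalExponents I) := by
  ext b
  simp [avoiding, box, monomial_mem_iff]

theorem setOf_monomial_mem_eq :
    {b | monomial b (1 : K) ∈ I} = {b | ∃ u ∈ minimalExponents I, u ≤ b} := by
  ext b
  simp [monomial_mem_iff]

theorem le_of_forall_add_le {d s : ℕ∞} {a N : ℕ} (hd : d + a ≤ N)
    (hs : ∀ k : ℕ, k + a ≤ N → (k : ℕ∞) ≤ s) : d ≤ s := by
  have hdt : d ≠ ⊤ := fun h => by simp [h] at hd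
  lift d to ℕ using hdt
  exact hs d (by exact_mod_cast hd)

theorem depth_le_sdepth_of_dominated (hI : IsMonomialIdeal I) (htop : I ≠ ⊤) (hbot : I ≠ ⊥)
    (hcard : ((minimalExponents I).card : ℕ∞) ≤ I.height + 1) {u : Fin n →₀ ℕ}
    (hu : u ∈ minimalExponents I)
    (hdom : ∀ x, 0 < u x → ∃ v ∈ (minimalExponents I).erase u, u x ≤ v x) :
    depth K n (PolyRing K n ⧸ I) ≤ sdepth (quotientGrading I) ∧
      depth K n I ≤ sdepth (idealGrading I) := by
  obtain ⟨P, hP, hle, hht⟩ := exists_associatedPrime_height_le hI htop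
  have huU := Finset.notMem_erase u (minimalExponents I)
  have hins := Finset.insert_erase hu
  have hU : (((minimalExponents I).erase u).card : ℕ∞) ≤ P.height := by
    rw [← Finset.card_erase_add_one hu, Nat.cast_add_one] at hcard
    exact (ENat.add_le_add_iff_right ENat.one_ne_top |>.1 hcard).trans hht
  -- As I is proper, `u` involves some variable, and the generator dominating it there differs from
  -- `u`.
  have hne : ((minimalExponents I).erase u).Nonempty := by
    obtain ⟨x, hx⟩ : ∃ x, u x ≠ 0 := by
      by_contra! h
      exact zero_notMem_minimalExponents htop ((Finsupp.ext h : u = 0) ▸ hu)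
    obtain ⟨v, hv, -⟩ := hdom x (Nat.pos_of_ne_zero hx)
    exact ⟨v, hv⟩
  constructor
  · refine le_of_forall_add_le ((add_le_add_right hU _).trans
      (depth_quotient_add_height_le hP hle)) fun k hk => le_sdepth_quotientGrading hI ?_
    rw [setOf_monomial_notMem_eq_avoiding, ← hins]
    exact boxPartition_avoiding_insert huU hdom (by simpa using hk)
  · refine le_of_forall_add_le (N := n + 1) ((add_le_add_right hU _).trans
      (by exact_mod_cast depth_ideal_add_height_le hbot hP hle))
      fun k hk => le_sdepth_idealGrading hI ?_
    rw [setOf_monomial_mem_eq, ← hins]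
    exact boxPartition_upperClosure_insert huU hne hdom (by simpa using hk)

theorem depth_le_sdepth_of_not_dominated (hI : IsMonomialIdeal I) (hbot : I ≠ ⊥)
    (h : ∀ u ∈ minimalExponents I, ∃ x, 0 < u x ∧ ∀ v ∈ (minimalExponents I).erase u, v x < u x) :
    depth K n (PolyRing K n ⧸ I) ≤ sdepth (quotientGrading I) ∧
      depth K n I ≤ sdepth (idealGrading I) := by
  have : Nonempty (Fin n) := by
    by_contra hn
    refine hbot ((Submodule.eq_bot_iff I).2 fun f hf => ?_)
    by_contra hf0
    obtain ⟨b, hb⟩ := Finset.nonempty_iff_ne_empty.2 (support_eq_empty.not.2 hf0)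
    obtain ⟨u, hu, -⟩ := monomial_mem_iff.1 (hI.mem_iff.1 hf b hb)
    exact hn ⟨(h u hu).choose⟩
  choose! x hpos hx using h
  have hx' : ∀ u ∈ minimalExponents I, ∀ v ∈ minimalExponents I, v ≠ u → v (x u) < u (x u) :=
    fun u hu v hv hvu => hx u hu v (Finset.mem_erase.2 ⟨hvu, hv⟩)
  have hP := span_X_image_mem_associatedPrimes hI hpos hx'
  have hle : Ideal.span (X '' ((minimalExponents I).image x : Set (Fin n))) ≤
      gradedMaximalIdeal K n := by
    rw [gradedMaximalIdeal_eq]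
    exact Ideal.span_mono (Set.image_mono (Set.subset_univ _))
  have hht := card_le_height_span_X_image (K := K) ((minimalExponents I).image x)
  rw [Finset.card_image_of_injOn] at hht
  · constructor
    · refine le_of_forall_add_le ((add_le_add_right hht _).trans
        (depth_quotient_add_height_le hP hle)) fun k hk => le_sdepth_quotientGrading hI ?_
      rw [setOf_monomial_notMem_eq_avoiding]
      exact boxPartition_avoiding _ _ _ (by simpa using hk)
    · refine le_of_forall_add_le (N := n + 1) ((add_le_add_right hht _).trans
        (by exact_mod_cast depth_ideal_add_height_le hbot hP hle))
        fun k hk => le_sdepth_idealGrading hI ?_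
      rw [setOf_monomial_mem_eq]
      exact boxPartition_upperClosure _ (by simpa using hk)
  -- Two generators sharing a chosen variable would each have the strictly larger exponent in it.
  · intro u hu v hv huv
    by_contra hne
    have h1 := hx' u hu v hv (Ne.symm hne)
    have h2 := hx' v hv u hu hne
    rw [huv] at h1
    omega

end AlmostCompleteIntersection

end StanleyDepth

end

theorem corollary1p8 {K : Type*} [Field K] {n : ℕ} (I : Ideal (StanleyDepth.PolyRing K n))
    (hmon : StanleyDepth.IsMonomialIdeal I)
    (haci : StanleyDepth.IsAlmostCompleteIntersection I) :
    StanleyDepth.depth K n (StanleyDepth.PolyRing K n ⧸ I) ≤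
        StanleyDepth.sdepth (StanleyDepth.quotientGrading I) ∧
      StanleyDepth.depth K n I ≤ StanleyDepth.sdepth (StanleyDepth.idealGrading I) := by
  obtain ⟨htop, -, hrank⟩ := haci
  have hbot : I ≠ ⊥ := by
    rintro rfl
    simp at hrank
  by_cases h : ∃ u ∈ StanleyDepth.minimalExponents I,
      ∀ x, 0 < u x → ∃ v ∈ (StanleyDepth.minimalExponents I).erase u, u x ≤ v x
  · obtain ⟨u, hu, hdom⟩ := h
    refine StanleyDepth.depth_le_sdepth_of_dominated hmon htop hbot ?_ hu hdom
    rw [← hrank]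
    exact_mod_cast StanleyDepth.card_minimalExponents_le hmon
  · push Not at h
    exact StanleyDepth.depth_le_sdepth_of_not_dominated hmon hbot h
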